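/- Conventions. A group is *torsion-free* if only its identity has finite order, and *metabelian* if its second derived subgroup is trivial. Modules are right modules. A finitely generated module $M$ over a ring $R$ is *stably free* if $M\oplus R^m$ is free for some $m\ge 0$. An element $x$ of a group $H$ is a *variable* of $H$ if there is a finite series $S_0\trianglelefteq S_1\trianglelefteq\dots\trianglelefteq S_n=H$ with $S_0$ abelian and all factors $S_{i+1}/S_i$ infinite cyclic such that, for some $j<n$, $S_j$ is abelian, $S_{j+1}$ is non-abelian, $x\in S_{j+1}$, and $xS_j$ generates $S_{j+1}/S_j\cong\mathbb{Z}$. (If $H$ is poly-infinite cyclic, one may equivalently require $S_0=1$.) For a group $H$, elements $x,y\in H$ and a polynomial $q\in\mathbb{Z}[X]$, put $r=q(y)$ and $s=xrx^{-1}$ in $\mathbb{Z}H$, and let $K_q(x,y)=\ker\lambda$, where $\lambda:(\mathbb{Z}H)^2\to\mathbb{Z}H$ is the homomorphism of right $\mathbb{Z}H$-modules with $\lambda(1,0)=r$ and $\lambda(0,1)=x+s$. Theorem. Let $G$ be a torsion-free group and let $N\trianglelefteq G$ be such that $G/N$ is torsion-free and metabelian and the abelianisation of $G/N$ is torsion-free.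 Let $\tau:G\to G/N$ be the quotient map, and let $\tau$ also denote the induced ring homomorphism $\mathbb{Z}G\to\mathbb{Z}[G/N]$. Suppose that $x',y'\in G$ satisfy: (i) $x=\tau(x')$ is a variable of $G/N$; (ii) $y'\in G'=[G,G]$; (iii) $y'$ and $x'y'x'^{-1}$ commute, and they have distinct images in $G/N$. Then $\mathbb{Z}G$ has a finitely generated stably free module that is not free. More precisely, put $y=\tau(y')$. For $q=1+X$ or for $q=1+X+X^3$, the right $\mathbb{Z}[G/N]$-module $K_q(x,y)$ and the right $\mathbb{Z}G$-module $K_q(x',y')$ are both finitely generated, stably free and not free, and the map $(a,b)\mapsto(\tau(a),\tau(b))$ restricts to a map $K_q(x',y')\to K_q(x,y)$ that exhibits $K_q(x,y)$ as the extension of scalars of $K_q(x',y')$ along $\tau$, i.e. it induces an isomorphism $K_q(x',y')\otimes_{\mathbb{Z}G}\mathbb{Z}[G/N]\cong K_q(x,y)$. -/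

import Mathlib

/-- A group is torsion-free if only the identity has finite order. -/
def IsTorsionFreeGroup (G : Type*) [Group G] : Prop :=
  ∀ g : G, IsOfFinOrder g → g = 1

/-- A group is metabelian if its second derived subgroup is trivial. -/
def IsMetabelianGroup (G : Type*) [Group G] : Prop :=
  derivedSeries G 2 = ⊥

/-- Any two elements of the subgroup `A` commute. -/
def IsAbelianSubgroup {H : Type*} [Group H] (A : Subgroup H) : Prop :=
  ∀ a ∈ A, ∀ b ∈ A, a * b = b * a

/-- `A` is a normal subgroup of `B` and `B / A` is infinite cyclic, i.e. `A` is the kernel of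
a surjective homomorphism from `B` to the integers. -/
def IsInfiniteCyclicStep {H : Type*} [Group H] (A B : Subgroup H) : Prop :=
  A ≤ B ∧ ∃ φ : B →* Multiplicative ℤ, Function.Surjective φ ∧ φ.ker = A.subgroupOf B

/-- `x` is a variable of `H`: there is a finite series `S 0 ⊴ S 1 ⊴ ... ⊴ S n = H` with infinite
cyclic factors and with `S 0` abelian such that, if `S (j + 1)` is its first non-abelian term, then
`x` lies in `S (j + 1)` and its class generates the infinite cyclic group `S (j + 1) / S j`.

For a poly-infinite-cyclic group `H` the series is usually required to start with `S 0 = 1`. Such a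
series is a series as above, and conversely in such a group every series as above can be refined to
one that starts with `1`, because its abelian first term is free abelian of finite rank. -/
def IsVariable {H : Type*} [Group H] (x : H) : Prop :=
  ∃ (n : ℕ) (S : ℕ → Subgroup H) (j : ℕ),
    IsAbelianSubgroup (S 0) ∧ S n = ⊤ ∧
    (∀ i < n, IsInfiniteCyclicStep (S i) (S (i + 1))) ∧
    j < n ∧ IsAbelianSubgroup (S j) ∧ ¬ IsAbelianSubgroup (S (j + 1)) ∧
    S j ⊔ Subgroup.zpowers x = S (j + 1)

/-- For ring elements `r`, `t`, the homomorphism of right `R`-modules `R² → R` with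
`(1, 0) ↦ r` and `(0, 1) ↦ t`. Right `R`-modules are modules over `Rᵐᵒᵖ`. -/
def rightRowMap {R : Type*} [Ring R] (r t : R) : (R × R) →ₗ[Rᵐᵒᵖ] R where
  toFun v := r * v.1 + t * v.2
  map_add' v w := by simp only [Prod.fst_add, Prod.snd_add, mul_add]; abel
  map_smul' c v := by
    simp only [Prod.smul_fst, Prod.smul_snd, MulOpposite.smul_eq_mul_unop, RingHom.id_apply,
      add_mul, mul_assoc]

/-- The right `ℤ[G]`-module `K(x, y) = ker (λ : ℤ[G]² → ℤ[G])`, where `λ (1, 0) = r` and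
`λ (0, 1) = x + s`, with `r = q(y)` for an integer polynomial `q`, and `s = x r x⁻¹`. -/
noncomputable def staffordModule {G : Type*} [Group G] (q : Polynomial ℤ) (x y : G) :
    Submodule (MonoidAlgebra ℤ G)ᵐᵒᵖ (MonoidAlgebra ℤ G × MonoidAlgebra ℤ G) :=
  LinearMap.ker (rightRowMap
    (Polynomial.aeval (MonoidAlgebra.of ℤ G y) q)
    (MonoidAlgebra.of ℤ G x + MonoidAlgebra.of ℤ G x * Polynomial.aeval (MonoidAlgebra.of ℤ G y) q * MonoidAlgebra.of ℤ G x⁻¹))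

/-- The `φ`-semilinear map `g : M → M'` exhibits the `B`-module `M'` as the extension of scalars of
the `A`-module `M` along `φ : A → B`. For right modules over rings `R` and `S`, one takes
`A = Rᵐᵒᵖ` and `B = Sᵐᵒᵖ`, and this says that `g` induces an isomorphism `M ⊗_R S ≅ M'`. -/
def IsExtensionOfScalars.{u} {A B : Type u} [Ring A] [Ring B] (φ : A →+* B)
    {M M' : Type u} [AddCommGroup M] [Module A M] [AddCommGroup M'] [Module B M']
    (g : M →ₛₗ[φ] M') : Prop :=
  ∀ (P : Type u) [AddCommGroup P] [Module B P] (h : M →ₛₗ[φ] P),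
    ∃! k : M' →ₗ[B] P, ∀ m, k (g m) = h m

/-- `M` is a finitely generated stably free module that is not free. -/
def IsStablyFreeNonFree (A M : Type*) [Ring A] [AddCommGroup M] [Module A M] : Prop :=
  Module.Finite A M ∧ Module.IsStablyFree A M ∧ ¬ Module.Free A M

/-- The ring homomorphism `ℤ[G] → ℤ[G / N]` induced by the quotient map, for the opposite rings. -/
noncomputable def groupRingQuotientOp {G : Type*} [Group G] (N : Subgroup G) [N.Normal] :
    (MonoidAlgebra ℤ G)ᵐᵒᵖ →+* (MonoidAlgebra ℤ (G ⧸ N))ᵐᵒᵖ :=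
  RingHom.op (MonoidAlgebra.mapDomainRingHom ℤ (QuotientGroup.mk' N))

/-! Since `r` and `s` commute and `x r = s x`, one has `r s + (x + s)(x - r) = x²`. So `λ` is split
onto, and its kernel `K` satisfies `K ⊕ R ≅ R²`. If `K` were free it would have rank one, hence a
single generator `(a, b)`.

Over `H = G/N`, grade `ℤ[H]` by `Γ = H^ab`. Explicit kernel elements, a unique-product argument
(which makes `b` homogeneous) and comparison of graded components force `s r₁ ∈ r ℤ[H]`, where `r₁ =
x⁻¹ r x` (`exists_eq_mul_of_generator`). A character of the torsion-free abelian group `[H, H]` that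
kills `r` but neither `s` nor `r₁`, extended by zero to `ℤ[H]`, rules this out.

The splitting is defined over `ℤ[G]`, so the kernel commutes with base change to `ℤ[H]`. A generator
upstairs would map to a generator downstairs. -/

/-! ### Invariant basis number and kernels of unimodular rows. -/

theorem InvariantBasisNumber.of_ringHom {A B : Type*} [Ring A] [Ring B] [InvariantBasisNumber B]
    (φ : A →+* B) : InvariantBasisNumber A where
  eq_of_fin_equiv {n m} e := by
    -- Matrices of mutually inverse maps remain mutually inverse after applying `φ` entrywise.
    have h (k l : ℕ) (f : (Fin k → A) ≃ₗ[A] (Fin l → A)) :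
        (LinearMap.toMatrixRight' f.toLinearMap).map φ *
          (LinearMap.toMatrixRight' f.symm.toLinearMap).map φ = 1 := by
      rw [← Matrix.map_mul]
      have : LinearMap.toMatrixRight' f.toLinearMap * LinearMap.toMatrixRight' f.symm.toLinearMap
          = 1 := by
        apply LinearMap.toMatrixRight'.symm.injective
        simp [Matrix.toLinearMapRight'_mul, Matrix.toLinearMapRight'_one]
      rw [this, Matrix.map_one _ (map_zero φ) (map_one φ)]
    exact InvariantBasisNumber.eq_of_fin_equiv (R := B) (Matrix.toLinearEquivRight'OfInv (h m n e.symm) (h n m e))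

section RowMap

variable {R : Type*} [Ring R]

/-- A ring is free of rank one as a right module over itself. -/
def opRegularEquiv (R : Type*) [Ring R] : R ≃ₗ[Rᵐᵒᵖ] Rᵐᵒᵖ where
  toFun := MulOpposite.op
  invFun := MulOpposite.unop
  map_add' _ _ := rfl
  map_smul' _ _ := rfl
  left_inv _ := rfl
  right_inv _ := rfl

instance opRegular_free : Module.Free Rᵐᵒᵖ R := Module.Free.of_equiv (opRegularEquiv R).symm

instance opRegular_finite : Module.Finite Rᵐᵒᵖ R := Module.Finite.equiv (opRegularEquiv R).symm

theorem rightRowMap_apply (r t : R) (v : R × R) :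
    rightRowMap r t v = r * v.1 + t * v.2 := rfl

theorem mem_ker_rightRowMap {r t : R} {v : R × R} :
    v ∈ LinearMap.ker (rightRowMap r t) ↔ r * v.1 + t * v.2 = 0 := Iff.rfl

/-- The projection `R² → ker (r, t)` attached to a relation `r u + t v = 1`. -/
def rowProj {r t u v : R} (h : r * u + t * v = 1) :
    (R × R) →ₗ[Rᵐᵒᵖ] LinearMap.ker (rightRowMap r t) where
  toFun w := ⟨(w.1 - u * (r * w.1 + t * w.2), w.2 - v * (r * w.1 + t * w.2)), by
    rw [mem_ker_rightRowMap]
    calc _ = (r * w.1 + t * w.2) - (r * u + t * v) * (r * w.1 + t * w.2) := by noncomm_ring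
      _ = 0 := by rw [h, one_mul, sub_self]⟩
  map_add' a b := by
    ext <;> simp <;> noncomm_ring
  map_smul' c a := by
    ext <;> simp [sub_mul, mul_add, add_mul, mul_assoc]

theorem rowProj_of_mem {r t u v : R} (h : r * u + t * v = 1)
    (w : LinearMap.ker (rightRowMap r t)) : rowProj h w = w := by
  have := mem_ker_rightRowMap.1 w.2
  ext <;> simp [rowProj, this]

theorem ker_rightRowMap_finite {r t u v : R} (h : r * u + t * v = 1) :
    Module.Finite Rᵐᵒᵖ (LinearMap.ker (rightRowMap r t)) :=
  Module.Finite.of_surjective (rowProj h) fun w => ⟨w, rowProj_of_mem h w⟩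

/-- The splitting `ker (r, t) ⊕ R ≃ R²` attached to a relation `r u + t v = 1`. -/
noncomputable def kerRowProdEquiv {r t u v : R} (h : r * u + t * v = 1) :
    (LinearMap.ker (rightRowMap r t) × R) ≃ₗ[Rᵐᵒᵖ] R × R :=
  LinearEquiv.ofBijective
    (LinearMap.coprod (Submodule.subtype _)
      ((LinearMap.toSpanSingleton Rᵐᵒᵖ (R × R) (u, v)).comp (opRegularEquiv R).toLinearMap)) <| by
    have key (a : LinearMap.ker (rightRowMap r t)) (c : R) :
        rightRowMap r t ((a : R × R) + (u * c, v * c)) = c := by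
      rw [map_add, LinearMap.mem_ker.1 a.2, rightRowMap_apply, zero_add, ← mul_assoc, ← mul_assoc,
        ← add_mul, h, one_mul]
    constructor
    · rintro ⟨a, c⟩ ⟨b, d⟩ hab
      have hab' : (a : R × R) + (u * c, v * c) = (b : R × R) + (u * d, v * d) := hab
      have hcd : c = d := by rw [← key a c, hab', key]
      subst hcd
      exact Prod.ext (Subtype.ext (add_right_cancel hab')) rfl
    · intro w
      refine ⟨(rowProj h w, r * w.1 + t * w.2), ?_⟩
      change ((rowProj h w : R × R) + (u * (r * w.1 + t * w.2), v * (r * w.1 + t * w.2))) = w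
      ext <;> simp [rowProj]

theorem ker_rightRowMap_isStablyFree {r t u v : R} (h : r * u + t * v = 1) :
    Module.IsStablyFree Rᵐᵒᵖ (LinearMap.ker (rightRowMap r t)) :=
  have : Module.Free Rᵐᵒᵖ (LinearMap.ker (rightRowMap r t) × R) :=
    Module.Free.of_equiv (kerRowProdEquiv h).symm
  .of_free_prod Rᵐᵒᵖ _ R

/-- Counting basis elements in `K ⊕ R ≅ R²` gives `K` rank one. -/
theorem ker_rightRowMap_exists_generator [InvariantBasisNumber Rᵐᵒᵖ] {r t u v : R}
    (h : r * u + t * v = 1) (_ : Module.Free Rᵐᵒᵖ (LinearMap.ker (rightRowMap r t))) :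
    ∃ e : LinearMap.ker (rightRowMap r t), ∀ w, ∃ c : Rᵐᵒᵖ, w = c • e := by
  have := nontrivial_of_invariantBasisNumber Rᵐᵒᵖ
  have := ker_rightRowMap_finite h
  let b := Module.Free.chooseBasis Rᵐᵒᵖ (LinearMap.ker (rightRowMap r t))
  let b₁ : Module.Basis Unit Rᵐᵒᵖ R :=
    (Module.Basis.singleton Unit Rᵐᵒᵖ).map (opRegularEquiv R).symm
  have e := ((b.prod b₁).map (kerRowProdEquiv h)).indexEquiv (b₁.prod b₁)
  have hcard := Fintype.card_congr e
  simp only [Fintype.card_sum, Fintype.card_unit, Nat.add_right_cancel_iff] at hcard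
  obtain ⟨i, hi⟩ := Fintype.card_eq_one_iff.1 hcard
  refine ⟨b i, fun w => ⟨b.repr w i, ?_⟩⟩
  have : Fintype.card _ = 1 := hcard
  conv_lhs => rw [← b.sum_repr w]
  refine Fintype.sum_eq_single i fun j hj => absurd (hi j) hj

end RowMap

/-! ### Base change of kernels. -/

section BaseChange

variable {R S : Type*} [Ring R] [Ring S]

/-- The map between kernels of row maps induced by a ring homomorphism. -/
def kerRowMap (f : R →+* S) {r t : R} {r' t' : S} (hr : f r = r') (ht : f t = t') :
    LinearMap.ker (rightRowMap r t) →ₛₗ[RingHom.op f] LinearMap.ker (rightRowMap r' t') where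
  toFun m := ⟨(f m.1.1, f m.1.2), by
    rw [mem_ker_rightRowMap, ← hr, ← ht, ← map_mul, ← map_mul, ← map_add,
      mem_ker_rightRowMap.1 m.2, map_zero]⟩
  map_add' a b := by ext <;> simp
  map_smul' c a := by ext <;> simp

variable {f : R →+* S} {r t u v : R} {r' t' : S} (hr : f r = r') (ht : f t = t')

theorem rowProj_map (h : r * u + t * v = 1) (h' : r' * f u + t' * f v = 1) (w : R × R) :
    kerRowMap f hr ht (rowProj h w) = rowProj h' (f w.1, f w.2) := by
  ext <;> simp [kerRowMap, rowProj, hr, ht]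

theorem prod_eq_smul_add_smul (w : S × S) :
    w = MulOpposite.op w.1 • ((1, 0) : S × S) + MulOpposite.op w.2 • ((0, 1) : S × S) := by
  ext <;> simp

/-- The projection of `R²` onto the kernel is compatible with `f`, so the projected standard basis
of `R²` maps to that of `S²`, which generates. -/
theorem kerRowMap_generators (h : r * u + t * v = 1)
    (m : LinearMap.ker (rightRowMap r' t')) :
    m = MulOpposite.op m.1.1 • kerRowMap f hr ht (rowProj h (1, 0)) +
      MulOpposite.op m.1.2 • kerRowMap f hr ht (rowProj h (0, 1)) := by
  have h' : r' * f u + t' * f v = 1 := by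
    rw [← hr, ← ht, ← map_mul, ← map_mul, ← map_add, h, map_one]
  rw [rowProj_map hr ht h h', rowProj_map hr ht h h']
  simp only [map_one, map_zero]
  rw [← map_smul, ← map_smul, ← map_add, ← prod_eq_smul_add_smul, rowProj_of_mem]

theorem kerRowMap_generator (h : r * u + t * v = 1) {e : LinearMap.ker (rightRowMap r t)}
    (he : ∀ w, ∃ c : Rᵐᵒᵖ, w = c • e) (w : LinearMap.ker (rightRowMap r' t')) :
    ∃ c : Sᵐᵒᵖ, w = c • kerRowMap f hr ht e := by
  obtain ⟨c₁, h₁⟩ := he (rowProj h (1, 0))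
  obtain ⟨c₂, h₂⟩ := he (rowProj h (0, 1))
  refine ⟨MulOpposite.op w.1.1 * RingHom.op f c₁ + MulOpposite.op w.1.2 * RingHom.op f c₂, ?_⟩
  conv_lhs => rw [kerRowMap_generators hr ht h w, h₁, h₂]
  rw [map_smulₛₗ, map_smulₛₗ, add_smul, mul_smul, mul_smul]

end BaseChange

theorem kerRowMap_isExtensionOfScalars.{u} {R S : Type u} [Ring R] [Ring S] {f : R →+* S}
    {r t a b : R} {r' t' : S} (hr : f r = r') (ht : f t = t') (h : r * a + t * b = 1) :
    IsExtensionOfScalars (RingHom.op f) (kerRowMap f hr ht) := by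
  intro P _ _ g
  let k₀ : (S × S) →ₗ[Sᵐᵒᵖ] P :=
    LinearMap.coprod
      ((LinearMap.toSpanSingleton Sᵐᵒᵖ P (g (rowProj h (1, 0)))).comp
        (opRegularEquiv S).toLinearMap)
      ((LinearMap.toSpanSingleton Sᵐᵒᵖ P (g (rowProj h (0, 1)))).comp
        (opRegularEquiv S).toLinearMap)
  refine ⟨k₀.comp (Submodule.subtype _), fun m => ?_, fun k hk => ?_⟩
  · have hm : m = MulOpposite.op m.1.1 • rowProj h (1, 0) +
        MulOpposite.op m.1.2 • rowProj h (0, 1) := by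
      rw [← map_smul, ← map_smul, ← map_add, ← prod_eq_smul_add_smul, rowProj_of_mem]
    conv_rhs => rw [hm, map_add, map_smulₛₗ, map_smulₛₗ]
    rfl
  · ext m
    conv_lhs => rw [kerRowMap_generators hr ht h m, map_add, map_smul, map_smul, hk, hk]
    rfl

/-! ### Unique products. -/

theorem isMulTorsionFree_of_isTorsionFreeGroup {A : Type*} [CommGroup A]
    (h : IsTorsionFreeGroup A) : IsMulTorsionFree A :=
  isMulTorsionFree_iff_not_isOfFinOrder.2 fun a ha ha' => ha (h a ha')

/-- A torsion-free abelian group embeds in a rational vector space, its divisible hull. -/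
theorem twoUniqueProds_of_isMulTorsionFree (A : Type*) [CommGroup A] [IsMulTorsionFree A] :
    TwoUniqueProds A := by
  have : TwoUniqueSums (Additive A) :=
    TwoUniqueSums.of_injective_addHom
      (DivisibleHull.coeAddMonoidHom (M := Additive A)).toAddHom
      (DivisibleHull.coe_injective (M := Additive A)) inferInstance
  exact TwoUniqueProds.of_injective_mulHom
    (G := Multiplicative (Additive A))
    { toFun := fun a => Multiplicative.ofAdd (Additive.ofMul a), map_mul' := fun _ _ => rfl }
    (fun _ _ h => h) inferInstance

/-- Pick a unique product of the images in `Γ`, then translate the two fibres over it into the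
kernel and pick one there. This is what makes `ℤ[H]` a domain. -/
theorem UniqueProds.of_ker {H Γ : Type*} [Group H] [Group Γ] (π : H →* Γ) [UniqueProds Γ]
    [UniqueProds π.ker] : UniqueProds H where
  uniqueMul_of_nonempty {A B} hA hB := by
    classical
    obtain ⟨α, hα, β, hβ, hu⟩ := UniqueProds.uniqueMul_of_nonempty (hA.image π) (hB.image π)
    obtain ⟨a, ha, rfl⟩ := Finset.mem_image.1 hα
    obtain ⟨b, hb, rfl⟩ := Finset.mem_image.1 hβ
    let A' : Finset π.ker := (A.image (a⁻¹ * ·)).subtype (· ∈ π.ker)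
    let B' : Finset π.ker := (B.image (· * b⁻¹)).subtype (· ∈ π.ker)
    have hA' : A'.Nonempty := ⟨1, by simpa [A', Finset.mem_subtype] using ha⟩
    have hB' : B'.Nonempty := ⟨1, by simpa [B', Finset.mem_subtype] using hb⟩
    obtain ⟨c, hc, d, hd, hcd⟩ := UniqueProds.uniqueMul_of_nonempty hA' hB'
    simp only [A', B', Finset.mem_subtype, Finset.mem_image] at hc hd
    obtain ⟨a₀, ha₀, hac⟩ := hc
    obtain ⟨b₀, hb₀, hbd⟩ := hd
    have hπa : π a₀ = π a := by
      have := c.2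
      rwa [← hac, MonoidHom.mem_ker, map_mul, map_inv, inv_mul_eq_one, eq_comm] at this
    have hπb : π b₀ = π b := by
      have := d.2
      rwa [← hbd, MonoidHom.mem_ker, map_mul, map_inv, mul_inv_eq_one] at this
    refine ⟨a₀, ha₀, b₀, hb₀, UniqueMul.of_image_filter (π : H →ₙ* Γ) hπa hπb hu ?_⟩
    intro a₁ b₁ ha₁ hb₁ hab
    simp only [Finset.mem_filter] at ha₁ hb₁
    have hπa₁ : π a₁ = π a := ha₁.2
    have hπb₁ : π b₁ = π b := hb₁.2
    have := @hcd ⟨a⁻¹ * a₁, by simp [MonoidHom.mem_ker, hπa₁]⟩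
      ⟨b₁ * b⁻¹, by simp [MonoidHom.mem_ker, hπb₁]⟩
      (by simpa [A', Finset.mem_subtype] using ha₁.1)
      (by simpa [B', Finset.mem_subtype] using hb₁.1)
      (by
        ext
        change a⁻¹ * a₁ * (b₁ * b⁻¹) = (c : H) * d
        rw [← hac, ← hbd]
        simp only [mul_assoc, mul_right_inj]
        simp only [← mul_assoc, hab])
    simp only [Subtype.ext_iff, ← hac, ← hbd, mul_right_inj, mul_left_inj] at this
    exact this

/-! ### Homogeneous elements and gradings. -/

namespace MonoidAlgebra

/-- If `f` had two terms, two distinct pairs would have unique products. Both would survive in `f *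
g`, so both would equal `γ`, against uniqueness. -/
theorem exists_eq_single_of_mul_eq_single {R Γ : Type*} [Ring R] [NoZeroDivisors R]
    [Group Γ] [TwoUniqueProds Γ] {f g : MonoidAlgebra R Γ} {γ : Γ} {c : R} (hc : c ≠ 0)
    (h : f * g = single γ c) : ∃ β b, f = single β b := by
  classical
  by_contra! hf
  have hf0 : f.coeff.support.Nonempty := by
    rw [Finsupp.support_nonempty_iff]
    intro h0
    exact hf 1 0 (by ext : 1; simp [h0])
  have hg0 : g.coeff.support.Nonempty := by
    rw [Finsupp.support_nonempty_iff]
    intro h0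
    have : g = 0 := by ext : 1; simpa using h0
    rw [this, mul_zero, eq_comm, single_eq_zero] at h
    exact hc h
  have hcard : 1 < f.coeff.support.card * g.coeff.support.card := by
    have h1 : f.coeff.support.card ≠ 1 := fun h1 => by
      obtain ⟨β, b, -, hb⟩ := Finsupp.card_support_eq_one'.1 h1
      exact hf β b (by ext : 1; simpa using hb)
    have h2 := hf0.card_pos
    have h3 := hg0.card_pos
    have h4 := Nat.mul_le_mul (show 2 ≤ f.coeff.support.card by omega) h3
    omega
  obtain ⟨p, hp, p', hp', hne, hu, hu'⟩ := TwoUniqueProds.uniqueMul_of_one_lt_card hcard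
  have aux (p : Γ × Γ) (hp : p ∈ f.coeff.support ×ˢ g.coeff.support)
      (hu : UniqueMul f.coeff.support g.coeff.support p.1 p.2) : p.1 * p.2 = γ := by
    rw [Finset.mem_product, Finsupp.mem_support_iff, Finsupp.mem_support_iff] at hp
    have := coeff_mul_mul_of_uniqueMul hu
    rw [h] at this
    by_contra hγ
    rw [coeff_single, Finsupp.single_eq_of_ne hγ] at this
    exact mul_ne_zero hp.1 hp.2 this.symm
  rw [Finset.mem_product] at hp
  obtain ⟨h1, h2⟩ := hu' hp.1 hp.2 ((aux p (Finset.mem_product.2 hp) hu).trans (aux p' hp' hu').symm)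
  exact hne (Prod.ext h1 h2)

section Coaction

variable {H Γ : Type*} [Group H] [Group Γ] (π : H →* Γ)

/-- The coaction `ℤ[H] → ℤ[H][Γ]`, `h ↦ h ⊗ π h`, that encodes the grading of `ℤ[H]` by `Γ`. -/
noncomputable def coaction : MonoidAlgebra ℤ H →+* MonoidAlgebra (MonoidAlgebra ℤ H) Γ :=
  (lift ℤ (MonoidAlgebra (MonoidAlgebra ℤ H) Γ) H
    { toFun := fun h => single (π h) (of ℤ H h)
      map_one' := by simp [one_def]
      map_mul' := fun a b => by simp [single_mul_single] }).toRingHom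

theorem coaction_of (h : H) : coaction π (of ℤ H h) = single (π h) (of ℤ H h) := by
  simp [coaction]

/-- The augmentation `R[Γ] → R`. -/
noncomputable def augmentation (R Γ : Type*) [Ring R] [Group Γ] : MonoidAlgebra R Γ →+* R :=
  liftNCRingHom (RingHom.id R) 1 fun _ _ => Commute.one_right _

theorem augmentation_single {R Γ : Type*} [Ring R] [Group Γ] (γ : Γ) (c : R) :
    augmentation R Γ (single γ c) = c := by
  simp [augmentation]

theorem augmentation_of {R Γ : Type*} [Ring R] [Group Γ] (γ : Γ) :
    augmentation R Γ (of R Γ γ) = 1 := by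
  simp [augmentation]

theorem augmentation_coaction (g : MonoidAlgebra ℤ H) :
    augmentation _ Γ (coaction π g) = g := by
  have : (augmentation (MonoidAlgebra ℤ H) Γ).comp (coaction π) = RingHom.id _ :=
    ringHom_ext (fun n => by
      rw [show (single 1 n : MonoidAlgebra ℤ H) = (n : MonoidAlgebra ℤ H) from (intCast_def n).symm]
      simp) (fun h => by
      have := congrArg (augmentation _ Γ) (coaction_of π h)
      simpa [augmentation_single] using this)
  exact congr($this g)

theorem coaction_eq_single {g : MonoidAlgebra ℤ H} {β : Γ} {b : MonoidAlgebra ℤ H}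
    (h : coaction π g = single β b) : coaction π g = single β g := by
  have := augmentation_coaction π g
  rw [h, augmentation_single] at this
  rw [h, this]

end Coaction

end MonoidAlgebra

/-! ### Characters separating `y` from its conjugates. -/

open Complex in
/-- Among the rational powers of the real root `-ρ` of `1 + X + X ^ 3`, taken along the branch
`exp (t (log ρ + iπ))`, only the first one is a root. -/
theorem exists_log_root_trinomial : ∃ z : ℂ, 1 + exp z + exp z ^ 3 = 0 ∧
    ∀ t : ℚ, 1 + exp (z * t) + exp (z * t) ^ 3 = 0 → t = 1 := by
  obtain ⟨ρ, hρI, hρ⟩ : ∃ ρ ∈ Set.Ioo (0 : ℝ) 1, ρ ^ 3 + ρ = 1 :=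
    intermediate_value_Ioo zero_le_one (f := fun ρ : ℝ => ρ ^ 3 + ρ) (by fun_prop)
      (by norm_num : (1 : ℝ) ∈ Set.Ioo _ _)
  have hmono {a b : ℝ} (ha : a ^ 3 + a = 1) (hb : b ^ 3 + b = 1) : a = b := by
    have h : (a - b) * (a ^ 2 + a * b + b ^ 2 + 1) = 0 := by linear_combination ha - hb
    rcases mul_eq_zero.1 h with h | h
    · linarith
    · nlinarith [sq_nonneg (a + b), sq_nonneg a, sq_nonneg b]
  set l := Real.log ρ with hl
  have hl0 : l < 0 := Real.log_neg hρI.1 hρI.2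
  have hexp : Real.exp l = ρ := Real.exp_log hρI.1
  have hz : exp (l + Real.pi * I) = -(ρ : ℂ) := by
    rw [exp_add, exp_pi_mul_I, ← ofReal_exp, hexp, mul_neg_one]
  refine ⟨l + Real.pi * I, ?_, fun t ht => ?_⟩
  · rw [hz]
    have : ((ρ ^ 3 + ρ : ℝ) : ℂ) = 1 := by rw [hρ, ofReal_one]
    push_cast at this
    linear_combination -this
  · set w := exp ((l + Real.pi * I) * t) with hw
    have hnorm : w.re ^ 2 + w.im ^ 2 = Real.exp (2 * (l * t)) := by
      have h1 : ‖w‖ = Real.exp (l * t) := by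
        rw [hw, norm_exp]
        congr 1
        simp
      rw [two_mul, Real.exp_add, ← h1, ← Complex.normSq_eq_norm_sq w |>.trans (sq _),
        Complex.normSq_apply]
      ring
    have hre : 1 + w.re + w.re ^ 3 - 3 * w.re * w.im ^ 2 = 0 := by
      have := congrArg Complex.re ht
      simp [pow_succ] at this
      linear_combination this
    have him : w.im * (1 + 3 * w.re ^ 2 - w.im ^ 2) = 0 := by
      have := congrArg Complex.im ht
      simp [pow_succ] at this
      linear_combination this
    -- A real root must be `-ρ`, and comparing moduli gives `t = 1`. A non-real root has modulus `ρ
    -- ^ (-1/2)`, forcing `t = -1/2`; then `w² = -1/ρ` is real, although `w` has nonzero real and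
    -- imaginary parts.
    rcases mul_eq_zero.1 him with h0 | h0
    · have hwre : -w.re = ρ := hmono (by rw [h0] at hre; linear_combination -hre) hρ
      have h2 : Real.exp (2 * (l * t)) = Real.exp (2 * l) := by
        rw [← hnorm, h0, two_mul l, Real.exp_add, hexp, ← hwre]
        ring
      have h3 : l * ((t : ℝ) - 1) = 0 := by linear_combination (Real.exp_injective h2) / 2
      have h4 : (t : ℝ) = 1 := by
        rcases mul_eq_zero.1 h3 with h | h
        · exact absurd h hl0.ne
        · linarith
      exact_mod_cast h4
    · have him2 : w.im ^ 2 = 1 + 3 * w.re ^ 2 := by linarith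
      have hwre : 2 * w.re = ρ := hmono (by rw [him2] at hre; linear_combination -hre) hρ
      have h2 : Real.exp (2 * (l * t)) = Real.exp (-l) := by
        have h5 : Real.exp (2 * (l * t)) * ρ = 1 := by
          rw [← hnorm, him2]
          have : w.re = ρ / 2 := by linarith
          rw [this]
          linear_combination hρ
        rw [Real.exp_neg, hexp]
        exact eq_inv_of_mul_eq_one_left h5
      have h3 : l * (2 * (t : ℝ) + 1) = 0 := by linear_combination Real.exp_injective h2
      have h4 : (2 * (t : ℝ) + 1) = 0 := by
        rcases mul_eq_zero.1 h3 with h | h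
        · exact absurd h hl0.ne
        · exact h
      have h4' : 2 * (t : ℂ) + 1 = 0 := by exact_mod_cast h4
      have h5 : w ^ 2 * -(ρ : ℂ) = 1 := by
        rw [← hz, hw, ← exp_nat_mul, ← exp_add, ← exp_zero]
        congr 1
        push_cast
        linear_combination ((l : ℂ) + Real.pi * I) * h4'
      have h6 := congrArg Complex.im h5
      simp [pow_succ] at h6
      have hρ0 := hρI.1
      have h7 : w.re ≠ 0 := by
        intro h
        rw [h, mul_zero] at hwre
        exact hρ0.ne hwre
      have h8 : w.im ≠ 0 := by
        intro h
        rw [h] at him2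
        nlinarith [sq_nonneg w.re]
      exfalso
      have h9 : w.re * w.im * (2 * ρ) = 0 := by
        rcases h6 with h6 | h6
        · linear_combination ρ * h6
        · exact absurd h6 hρ0.ne'
      exact mul_ne_zero (mul_ne_zero h7 h8) (by positivity) h9

/-- Some rational functional on the divisible hull is nonzero at `a`, `b - a` and `c - a`; rescale
it to be `1` at `a`. -/
theorem exists_addMonoidHom_rat {M : Type*} [AddCommGroup M] [IsAddTorsionFree M] {a b c : M}
    (ha : a ≠ 0) (hb : b ≠ a) (hc : c ≠ a) :
    ∃ f : M →+ ℚ, f a = 1 ∧ f b ≠ 1 ∧ f c ≠ 1 := by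
  let j := DivisibleHull.coeAddMonoidHom (M := M)
  have hj : Function.Injective j := DivisibleHull.coe_injective
  have hj' {m : M} (hm : m ≠ 0) : j m ≠ 0 := fun h => hm (hj (h.trans (map_zero j).symm))
  obtain ⟨φ, hφ⟩ := Module.exists_dual_forall_apply_ne_zero (K := ℚ) ![j a, j (b - a), j (c - a)]
    (by
      intro i
      fin_cases i
      · exact hj' ha
      · exact hj' (sub_ne_zero.2 hb)
      · exact hj' (sub_ne_zero.2 hc))
  have h0 : φ (j a) ≠ 0 := hφ 0
  have h1 : φ (j (b - a)) ≠ 0 := hφ 1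
  have h2 : φ (j (c - a)) ≠ 0 := hφ 2
  rw [map_sub, map_sub, sub_ne_zero] at h1 h2
  let f : M →+ ℚ := ((φ (j a))⁻¹ • φ).toAddMonoidHom.comp j
  have hf (m : M) : f m = (φ (j a))⁻¹ * φ (j m) := rfl
  refine ⟨f, ?_, ?_, ?_⟩
  · rw [hf, inv_mul_cancel₀ h0]
  · rwa [hf, ne_eq, inv_mul_eq_one₀ h0, eq_comm]
  · rwa [hf, ne_eq, inv_mul_eq_one₀ h0, eq_comm]

theorem exists_character_trinomial {A : Type*} [CommGroup A] [IsMulTorsionFree A] {a b c : A}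
    (ha : a ≠ 1) (hb : b ≠ a) (hc : c ≠ a) :
    ∃ χ : A →* ℂ, 1 + χ a + χ a ^ 3 = 0 ∧ 1 + χ b + χ b ^ 3 ≠ 0 ∧ 1 + χ c + χ c ^ 3 ≠ 0 := by
  obtain ⟨z, hz, hz'⟩ := exists_log_root_trinomial
  obtain ⟨f, hfa, hfb, hfc⟩ := exists_addMonoidHom_rat (M := Additive A)
    (a := Additive.ofMul a) (b := Additive.ofMul b) (c := Additive.ofMul c) ha hb hc
  let χ : A →* ℂ :=
    { toFun := fun a => Complex.exp (z * (f (Additive.ofMul a) : ℚ))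
      map_one' := by simp
      map_mul' := fun a b => by simp [mul_add, Complex.exp_add] }
  refine ⟨χ, ?_, fun h => hfb (hz' _ h), fun h => hfc (hz' _ h)⟩
  change 1 + Complex.exp (z * (f (Additive.ofMul a) : ℚ)) +
    Complex.exp (z * (f (Additive.ofMul a) : ℚ)) ^ 3 = 0
  rwa [hfa, Rat.cast_one, mul_one]

/-- Left multiplication by an element of `A` preserves both `A` and its complement, so extension by
zero stays linear over `ℤ[A]` on the left. -/
theorem exists_extension_by_zero {H : Type*} [Group H] (A : Subgroup H) (χ : A →* ℂ) :
    ∃ Φ : MonoidAlgebra ℤ H →+ ℂ, Φ 1 = 1 ∧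
      ∀ (a : A) (w : MonoidAlgebra ℤ H), Φ (MonoidAlgebra.of ℤ H a * w) = χ a * Φ w := by
  classical
  let Φ : MonoidAlgebra ℤ H →+ ℂ := MonoidAlgebra.liftNC (Int.castAddHom ℂ)
    fun h => if hh : h ∈ A then χ ⟨h, hh⟩ else 0
  refine ⟨Φ, ?_, fun a w => ?_⟩
  · have : χ ⟨1, A.one_mem⟩ = 1 := map_one χ
    simp [Φ, MonoidAlgebra.one_def, MonoidAlgebra.liftNC_single, this]
  · induction w using MonoidAlgebra.induction_linear with
    | zero => simp
    | add u v hu hv => rw [mul_add, map_add, map_add, hu, hv, mul_add]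
    | single h n =>
      by_cases hh : h ∈ A
      · have : χ ⟨a * h, A.mul_mem a.2 hh⟩ = χ a * χ ⟨h, hh⟩ := map_mul χ a ⟨h, hh⟩
        simp [Φ, MonoidAlgebra.liftNC_single, MonoidAlgebra.single_mul_single, hh,
          A.mul_mem_cancel_left a.2, this]
        ring
      · simp [Φ, MonoidAlgebra.liftNC_single, MonoidAlgebra.single_mul_single, hh,
          A.mul_mem_cancel_left a.2]

/-! ### The unimodular row `(r, x + s)`. -/

theorem stafford_relation {R : Type*} [Ring R] {r s x x' : R} (hx : x * x' = 1)
    (hxr : x * r = s * x) (hrs : Commute r s) :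
    r * (s * x' * x') + (x + s) * ((x - r) * x' * x') = 1 := by
  have h1 : r * (s * x' * x') + (x + s) * ((x - r) * x' * x') =
      x * (x * x') * x' + (r * s - s * r) * x' * x' + (s * x - x * r) * x' * x' := by
    noncomm_ring
  rw [h1, hxr, hrs.eq, hx, mul_one, hx]
  simp

open MonoidAlgebra

section Stafford

variable {G : Type*} [Group G] (q : Polynomial ℤ) (x y : G)

theorem aeval_of_conj : of ℤ G x * Polynomial.aeval (of ℤ G y) q * of ℤ G x⁻¹ =
    Polynomial.aeval (of ℤ G (x * y * x⁻¹)) q := by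
  induction q using Polynomial.induction_on' with
  | add p q hp hq => rw [map_add, map_add, mul_add, add_mul, hp, hq]
  | monomial n a =>
    rw [Polynomial.aeval_monomial, Polynomial.aeval_monomial, ← map_pow, ← map_pow, conj_pow]
    simp only [map_mul, ← Algebra.smul_def, mul_smul_comm, smul_mul_assoc]

theorem of_mul_aeval : of ℤ G x * Polynomial.aeval (of ℤ G y) q =
    Polynomial.aeval (of ℤ G (x * y * x⁻¹)) q * of ℤ G x := by
  rw [← aeval_of_conj, mul_assoc, ← map_mul, inv_mul_cancel, map_one, mul_one]

variable {y} in
theorem aeval_of_commute {z : G} (h : Commute y z) :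
    Commute (Polynomial.aeval (of ℤ G y) q) (Polynomial.aeval (of ℤ G z) q) := by
  have (a : MonoidAlgebra ℤ G) (w : G) (ha : Commute a (of ℤ G w)) :
      Commute a (Polynomial.aeval (of ℤ G w) q) := by
    induction q using Polynomial.induction_on' with
    | add p q hp hq => rw [map_add]; exact hp.add_right hq
    | monomial n c =>
      rw [Polynomial.aeval_monomial]
      exact Commute.mul_right (Algebra.commutes c a).symm (ha.pow_right n)
  exact this _ _ (this _ _ (h.map (of ℤ G)).symm).symm

theorem staffordModule_relation (h : Commute y (x * y * x⁻¹)) :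
    ∃ u v : MonoidAlgebra ℤ G, Polynomial.aeval (of ℤ G y) q * u +
      (of ℤ G x + of ℤ G x * Polynomial.aeval (of ℤ G y) q * of ℤ G x⁻¹) * v = 1 := by
  refine ⟨_, _, stafford_relation (x' := of ℤ G x⁻¹) ?_ ?_ ?_⟩
  · rw [← map_mul, mul_inv_cancel, map_one]
  · rw [aeval_of_conj, of_mul_aeval]
  · rw [aeval_of_conj]
    exact aeval_of_commute q h

end Stafford

/-! ### Non-freeness over the group rings. -/

theorem invariantBasisNumber_op_intGroupRing (G : Type*) [Group G] :
    InvariantBasisNumber (MonoidAlgebra ℤ G)ᵐᵒᵖ :=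
  .of_ringHom ((RingEquiv.toOpposite ℤ).symm.toRingHom.comp (RingHom.op (augmentation ℤ G)))

/-- If the kernel of `(r, x + s)` is cyclic then `r` divides `s r₁`, where `r₁ = x⁻¹ r x`. -/
theorem exists_eq_mul_of_generator {H Γ : Type*} [Group H] [Group Γ] [TwoUniqueProds Γ]
    [NoZeroDivisors (MonoidAlgebra ℤ H)] (π : H →* Γ) {x : H} (hx : π x ≠ 1)
    {r s r₁ r₂ : MonoidAlgebra ℤ H}
    (hr : coaction π r = single 1 r) (hs : coaction π s = single 1 s)
    (hr₁ : coaction π r₁ = single 1 r₁) (hr₂ : coaction π r₂ = single 1 r₂)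
    (hr0 : r * r₁ ≠ 0) (hxr : of ℤ H x * r = s * of ℤ H x) (hxr₁ : of ℤ H x * r₁ = r * of ℤ H x)
    (hxr₂ : of ℤ H x * r₂ = r₁ * of ℤ H x) (hrs : Commute r s)
    {e : LinearMap.ker (rightRowMap r (of ℤ H x + s))}
    (he : ∀ w, ∃ c : (MonoidAlgebra ℤ H)ᵐᵒᵖ, w = c • e) :
    ∃ w, s * r₁ = r * w := by
  classical
  obtain ⟨a, b, hab, key⟩ : ∃ a b, r * a + (of ℤ H x + s) * b = 0 ∧
      ∀ c d, r * c + (of ℤ H x + s) * d = 0 → ∃ g, d = b * g :=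
    ⟨e.1.1, e.1.2, mem_ker_rightRowMap.1 e.2, fun c d h => by
      obtain ⟨g, hg⟩ := he ⟨(c, d), h⟩
      exact ⟨g.unop, congrArg (fun m => m.1.2) hg⟩⟩
  set X := of ℤ H x
  -- Here `r r₁` is a second coordinate because `x r r₁ = s r x = r s x`.
  obtain ⟨g, hg⟩ := key (-(s * X + s * r₁)) (r * r₁) (by
    have : r * -(s * X + s * r₁) + (X + s) * (r * r₁) =
      X * r * r₁ - r * s * X + (s * r - r * s) * r₁ := by noncomm_ring
    rw [this, hxr, mul_assoc, hxr₁, ← mul_assoc, hrs.eq]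
    simp)
  -- The term `-r r₂` is chosen so that `x r r₂ = s r₁ x` cancels the cross term.
  obtain ⟨g', hg'⟩ := key (-(X * X) + s * r₂) (r₁ * X - r * r₂) (by
    have : r * (-(X * X) + s * r₂) + (X + s) * (r₁ * X - r * r₂) =
      (X * r₁ - r * X) * X - (X * r) * r₂ + s * (r₁ * X) + (r * s - s * r) * r₂ := by noncomm_ring
    rw [this, hxr, hxr₁, hrs.eq, ← hxr₂]
    simp [mul_assoc])
  -- `b` divides `r r₁`, which is nonzero and homogeneous of degree `1`.
  obtain ⟨β, c, hb⟩ := exists_eq_single_of_mul_eq_single (f := coaction π b) (g := coaction π g)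
    (γ := 1) hr0 (by rw [← map_mul, ← hg, map_mul, hr, hr₁, single_mul_single, one_mul])
  replace hb := coaction_eq_single π hb
  have hX : coaction π X = single (π x) X := coaction_of π x
  -- Degree `β` part of `r a + (x + s) b = 0`; `x b` has degree `π x * β ≠ β`.
  obtain ⟨w, hw⟩ : ∃ w, s * b = r * w := by
    refine ⟨-(coaction π a).coeff β, ?_⟩
    have := congrArg (fun f => (coaction π f).coeff β) hab
    simp only [map_add, map_mul, hr, hs, hb, hX, add_mul, single_mul_single, one_mul,
      coeff_add, Finsupp.add_apply, coeff_single, Finsupp.single_eq_same, map_zero, coeff_zero,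
      Finsupp.zero_apply, coeff_single_one_mul] at this
    rw [Finsupp.single_eq_of_ne (by simpa [eq_comm] using hx), zero_add] at this
    rw [mul_neg]
    exact eq_neg_of_add_eq_zero_right this
  -- Degree `π x` part of `r₁ x - r r₂ = b g'`; `r r₂` has degree `1`.
  obtain ⟨w', hw'⟩ : ∃ w', r₁ * X = b * w' := by
    refine ⟨(coaction π g').coeff (β⁻¹ * π x), ?_⟩
    have := congrArg (fun f => (coaction π f).coeff (π x)) hg'
    simp only [map_sub, map_mul, hr, hr₁, hr₂, hb, hX, single_mul_single, one_mul, coeff_sub,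
      Finsupp.sub_apply, coeff_single, Finsupp.single_eq_same, coeff_single_mul_apply] at this
    rwa [Finsupp.single_eq_of_ne hx, sub_zero] at this
  refine ⟨w * w' * of ℤ H x⁻¹, ?_⟩
  have hXX : X * of ℤ H x⁻¹ = 1 := by rw [← map_mul, mul_inv_cancel, map_one]
  calc s * r₁ = s * (r₁ * X) * of ℤ H x⁻¹ := by simp only [mul_assoc, hXX, mul_one]
    _ = r * (w * w' * of ℤ H x⁻¹) := by
      rw [hw', ← mul_assoc s, hw]
      simp only [mul_assoc]

theorem commute_of_mem_commutator {H : Type*} [Group H] (hmet : IsMetabelianGroup H) {a b : H}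
    (ha : a ∈ commutator H) (hb : b ∈ commutator H) : a * b = b * a := by
  have h : ⁅commutator H, commutator H⁆ = ⊥ := by
    rw [← hmet, derivedSeries_succ, derivedSeries_one]
  have := Subgroup.commutator_mem_commutator ha hb
  rw [h, Subgroup.mem_bot, commutatorElement_eq_one_iff_mul_comm] at this
  exact this

theorem staffordModule_not_cyclic {H : Type*} [Group H] (hH : IsTorsionFreeGroup H)
    (hmet : IsMetabelianGroup H) (hab : IsTorsionFreeGroup (Abelianization H)) {x y : H}
    (hy : y ∈ commutator H) (hne : y ≠ x * y * x⁻¹)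
    (e : staffordModule (1 + Polynomial.X + Polynomial.X ^ 3) x y) :
    ¬ ∀ w, ∃ c : (MonoidAlgebra ℤ H)ᵐᵒᵖ, w = c • e := by
  intro he
  let _ : CommGroup (commutator H) :=
    { mul_comm := fun a b => Subtype.ext (commute_of_mem_commutator hmet a.2 b.2) }
  have hA : IsMulTorsionFree (commutator H) := isMulTorsionFree_of_isTorsionFreeGroup fun a ha =>
    Subtype.ext (hH a ((commutator H).subtype.isOfFinOrder ha))
  have hΓ : IsMulTorsionFree (Abelianization H) := isMulTorsionFree_of_isTorsionFreeGroup hab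
  have hΓ2 := twoUniqueProds_of_isMulTorsionFree (Abelianization H)
  have hA2 := twoUniqueProds_of_isMulTorsionFree (commutator H)
  let π : H →* Abelianization H := Abelianization.of
  have hker : π.ker = commutator H := Abelianization.ker_of H
  have hU : UniqueProds π.ker := by rw [hker]; infer_instance
  have hH2 : UniqueProds H := UniqueProds.of_ker π
  -- An `x` in the abelian group `[H, H]` would commute with `y`.
  have hx : π x ≠ 1 := fun h => hne <| by
    have : x ∈ commutator H := hker ▸ MonoidHom.mem_ker.2 h
    rw [commute_of_mem_commutator hmet this hy, mul_inv_cancel_right]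
  have hconj (g : H) : g * y * g⁻¹ ∈ commutator H := Subgroup.Normal.conj_mem inferInstance y hy g
  have hπ (a : H) (ha : a ∈ commutator H) : π a = 1 := by rwa [← MonoidHom.mem_ker, hker]
  let q : Polynomial ℤ := 1 + Polynomial.X + Polynomial.X ^ 3
  let Q (h : H) : MonoidAlgebra ℤ H := Polynomial.aeval (of ℤ H h) q
  have hQ (h : H) : Q h = 1 + of ℤ H h + of ℤ H h ^ 3 := by simp [Q, q]
  have hQX (h k : H) (hk : x * h * x⁻¹ = k) : of ℤ H x * Q h = Q k * of ℤ H x := by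
    rw [of_mul_aeval, hk]
  have hQc (a : H) (ha : a ∈ commutator H) : coaction π (Q a) = single 1 (Q a) := by
    rw [hQ, map_add, map_add, map_one, map_pow, coaction_of, hπ a ha, single_pow, one_pow,
      single_add, single_add]
    rfl
  have hQaug (a : H) : augmentation ℤ H (Q a) = 3 := by
    rw [hQ, map_add, map_add, map_one, map_pow, augmentation_of]
    norm_num
  obtain ⟨y₁, hy₁⟩ : ∃ y₁ : commutator H, (y₁ : H) = x * y * x⁻¹ := ⟨⟨_, hconj x⟩, rfl⟩
  obtain ⟨y₂, hy₂⟩ : ∃ y₂ : commutator H, (y₂ : H) = x⁻¹ * y * x⁻¹⁻¹ := ⟨⟨_, hconj x⁻¹⟩, rfl⟩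
  obtain ⟨y₃, hy₃⟩ : ∃ y₃ : commutator H, (y₃ : H) = (x ^ 2)⁻¹ * y * (x ^ 2)⁻¹⁻¹ :=
    ⟨⟨_, hconj (x ^ 2)⁻¹⟩, rfl⟩
  lift y to commutator H using hy
  have hK : ∃ e : LinearMap.ker (rightRowMap (Q y) (of ℤ H x + Q y₁)),
      ∀ w, ∃ c : (MonoidAlgebra ℤ H)ᵐᵒᵖ, w = c • e := by
    rw [hy₁, show Q (x * y * x⁻¹) = _ from (aeval_of_conj q x y).symm]
    exact ⟨e, he⟩
  obtain ⟨e', he'⟩ := hK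
  obtain ⟨w, hw⟩ := exists_eq_mul_of_generator π hx (hQc _ y.2) (hQc _ y₁.2) (hQc _ y₂.2)
    (hQc _ y₃.2) (fun h => by
      have := congrArg (augmentation ℤ H) h
      rw [map_mul, hQaug, hQaug, map_zero] at this
      norm_num at this)
    (hQX _ _ hy₁.symm) (hQX _ _ (by rw [hy₂]; group)) (hQX _ _ (by rw [hy₂, hy₃]; group))
    (aeval_of_commute q (commute_of_mem_commutator hmet y.2 y₁.2)) he'
  obtain ⟨χ, h0, h1, h2⟩ := exists_character_trinomial (a := y) (b := y₁) (c := y₂)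
    (fun h => hne (by rw [h]; simp))
    (fun h => hne (by rw [← hy₁, h]))
    (fun h => hne (by
      have h' : (y : H) = x⁻¹ * y * x⁻¹⁻¹ := by rw [← hy₂, h]
      conv_rhs => rw [h']
      group))
  obtain ⟨Φ, hΦ1, hΦ⟩ := exists_extension_by_zero (commutator H) χ
  have hΦQ (a : commutator H) (w : MonoidAlgebra ℤ H) :
      Φ (Q a * w) = (1 + χ a + χ a ^ 3) * Φ w := by
    rw [hQ, pow_succ, sq]
    simp only [add_mul, one_mul, mul_assoc, map_add, hΦ]
    ring
  -- `Φ` sends `r w` to `0`, but `s r₁` to a product of two nonzero values of `q`.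
  have := congrArg Φ hw
  rw [hΦQ, hΦQ, h0, zero_mul, ← mul_one (Q y₂), hΦQ, hΦ1, mul_one] at this
  exact mul_ne_zero h1 h2 this

theorem mainTheorem6 {G : Type*} [Group G] (N : Subgroup G) [N.Normal]
    (hG : IsTorsionFreeGroup G)
    (hQ : IsTorsionFreeGroup (G ⧸ N))
    (hmet : IsMetabelianGroup (G ⧸ N))
    (hab : IsTorsionFreeGroup (Abelianization (G ⧸ N)))
    (x' y' : G)
    (hx : IsVariable (x' : G ⧸ N))
    (hy : y' ∈ commutator G)
    (hcomm : Commute y' (x' * y' * x'⁻¹))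
    (hne : ((y' : G) : G ⧸ N) ≠ ((x' * y' * x'⁻¹ : G) : G ⧸ N)) :
    ∃ q : Polynomial ℤ,
      (q = 1 + Polynomial.X ∨ q = 1 + Polynomial.X + Polynomial.X ^ 3) ∧
      IsStablyFreeNonFree (MonoidAlgebra ℤ (G ⧸ N))ᵐᵒᵖ
        (staffordModule q (x' : G ⧸ N) (y' : G ⧸ N)) ∧
      IsStablyFreeNonFree (MonoidAlgebra ℤ G)ᵐᵒᵖ (staffordModule q x' y') ∧
      ∃ g : staffordModule q x' y' →ₛₗ[groupRingQuotientOp N]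
          staffordModule q (x' : G ⧸ N) (y' : G ⧸ N),
        (∀ m, (g m : MonoidAlgebra ℤ (G ⧸ N) × MonoidAlgebra ℤ (G ⧸ N)) =
          (MonoidAlgebra.mapDomainRingHom ℤ (QuotientGroup.mk' N) m.1.1,
           MonoidAlgebra.mapDomainRingHom ℤ (QuotientGroup.mk' N) m.1.2)) ∧
        IsExtensionOfScalars (groupRingQuotientOp N) g := by
  have hcomm' : Commute (y' : G ⧸ N) ((x' : G ⧸ N) * y' * (x' : G ⧸ N)⁻¹) :=
    hcomm.map (QuotientGroup.mk' N)
  have hy' : (y' : G ⧸ N) ∈ commutator (G ⧸ N) := by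
    have h := Subgroup.mem_map_of_mem (QuotientGroup.mk' N) hy
    rw [commutator_def, Subgroup.map_commutator] at h
    exact Subgroup.commutator_mono le_top le_top h
  -- The trinomial works in every case. For `1 + X`, the powers `exp (iπt)` of the root `-1` return
  -- to it at every odd `t`, so the character could fail to separate conjugates.
  let q : Polynomial ℤ := 1 + Polynomial.X + Polynomial.X ^ 3
  let τ : MonoidAlgebra ℤ G →+* MonoidAlgebra ℤ (G ⧸ N) :=
    MonoidAlgebra.mapDomainRingHom ℤ (QuotientGroup.mk' N)
  have hτ (g : G) : τ (of ℤ G g) = of ℤ (G ⧸ N) g := by simp [τ]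
  have hr : τ (Polynomial.aeval (of ℤ G y') q) = Polynomial.aeval (of ℤ (G ⧸ N) y') q := by
    simp only [q, map_add, map_one, map_pow, Polynomial.aeval_X, hτ]
  have ht : τ (of ℤ G x' + of ℤ G x' * Polynomial.aeval (of ℤ G y') q * of ℤ G x'⁻¹) =
      of ℤ (G ⧸ N) x' + of ℤ (G ⧸ N) x' * Polynomial.aeval (of ℤ (G ⧸ N) y') q *
        of ℤ (G ⧸ N) (x' : G ⧸ N)⁻¹ := by
    rw [map_add, map_mul, map_mul, hr, hτ, hτ, QuotientGroup.mk_inv]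
  obtain ⟨u, v, h⟩ := staffordModule_relation q x' y' hcomm
  obtain ⟨u', v', h'⟩ := staffordModule_relation q (x' : G ⧸ N) (y' : G ⧸ N) hcomm'
  have hcyc := staffordModule_not_cyclic hQ hmet hab (x := (x' : G ⧸ N)) hy' hne
  refine ⟨q, Or.inr rfl, ⟨ker_rightRowMap_finite h', ker_rightRowMap_isStablyFree h', ?_⟩,
    ⟨ker_rightRowMap_finite h, ker_rightRowMap_isStablyFree h, ?_⟩,
    kerRowMap τ hr ht, fun _ => rfl, kerRowMap_isExtensionOfScalars hr ht h⟩
  · intro hfree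
    have := invariantBasisNumber_op_intGroupRing (G ⧸ N)
    obtain ⟨e, he⟩ := ker_rightRowMap_exists_generator h' hfree
    exact hcyc e he
  · intro hfree
    have := invariantBasisNumber_op_intGroupRing G
    obtain ⟨e, he⟩ := ker_rightRowMap_exists_generator h hfree
    exact hcyc _ (kerRowMap_generator hr ht h he)
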